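/- Let $q$ be a prime power and let $1 \le \ell \le m$ be integers. Let $\mathcal{G}_{\ell,m}$ be the set of all $\ell$-dimensional linear subspaces of $\mathbb{F}_q^m$, and for each $W \in \mathcal{G}_{\ell,m}$ choose an $\ell \times m$ matrix $M_W$ over $\mathbb{F}_q$ whose row space is $W$. For $I = (i_1 < \dots < i_\ell)$ with $1 \le i_1$ and $i_\ell \le m$, let $\det_I(M_W)$ be the determinant of the $\ell\times\ell$ submatrix of $M_W$ formed by the columns $i_1,\dots,i_\ell$. The Grassmann code $C(\ell,m) \subseteq \mathbb{F}_q^{\mathcal{G}_{\ell,m}}$ is the row space of the matrix $\left(\det_I(M_W)\right)_{I,W}$, whose rows are indexed by the tuples $I$ and whose columns are indexed by the subspaces $W$. Then for every choice of the matrices $M_W$ and every codeword $c \in C(\ell,m)$, with support $\operatorname{supp}(c) = \{W \in \mathcal{G}_{\ell,m} : c_W \neq 0\}$, the number $q^{m-\ell}$ divides $\#\operatorname{supp}(c)$, and, if $\ell < m$, the number $q^{\ell}$ also divides $\#\operatorname{supp}(c)$. -/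

import Mathlib

/-- The Grassmannian: the set of all `ℓ`-dimensional `F`-linear subspaces of `F ^ m`. -/
abbrev GrassmannSet (F : Type*) [Field F] (ℓ m : ℕ) : Type _ :=
  {W : Submodule F (Fin m → F) // Module.finrank F W = ℓ}

/-- A choice, for every `W` in the Grassmannian, of an `ℓ × m` matrix whose row space is `W`. -/
def IsRowSpaceChoice {F : Type*} [Field F] {ℓ m : ℕ}
    (M : GrassmannSet F ℓ m → Matrix (Fin ℓ) (Fin m) F) : Prop :=
  ∀ W : GrassmannSet F ℓ m, Submodule.span F (Set.range (M W).row) = W.1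

/-- The maximal minors of the chosen matrices: the rows are indexed by the strictly increasing
`ℓ`-tuples `I` in `{1, …, m}`, the columns by the Grassmannian, and the entry at `(I, W)` is the
determinant of the submatrix of `M W` formed by the columns listed in `I`. -/
def grassmannGenerator {F : Type*} [Field F] {ℓ m : ℕ}
    (M : GrassmannSet F ℓ m → Matrix (Fin ℓ) (Fin m) F) :
    Matrix (Fin ℓ ↪o Fin m) (GrassmannSet F ℓ m) F :=
  Matrix.of fun I W => ((M W).submatrix id I).det

/-- The Grassmann code (for the chosen matrices): the row space of the matrix of minors. -/
def grassmannCode {F : Type*} [Field F] {ℓ m : ℕ}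
    (M : GrassmannSet F ℓ m → Matrix (Fin ℓ) (Fin m) F) :
    Submodule F (GrassmannSet F ℓ m → F) :=
  Submodule.span F (Set.range (grassmannGenerator M).row)

/-! A codeword evaluates an alternating form `f` of degree `ℓ` on row bases, so its weight `w`
counts the `W` of dimension `ℓ` with `f|W ≠ 0`. A nonzero top form is nonzero on every basis, so `f
v ≠ 0` for exactly `w * |GL_ℓ(q)|` tuples `v`. Two further counts, with `n = dim V`:

Extend `v` by an independent vector and group by the span `X`. A nonzero `ℓ`-form on an
`(ℓ+1)`-dimensional space is a determinant pulled back from a quotient by a line, so each `X` with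
`f|X ≠ 0` contributes equally. Cancelling gives `w * (q^(n-ℓ) - 1) = N * q^ℓ * (q - 1)`.

Fix all entries of `v` but the first: `f` becomes a linear functional, zero or nonzero at `q^(n-1) *
(q - 1)` vectors. Which case occurs depends only on the span of the fixed entries, whence `w * (q^ℓ
- 1) = N' * q^(n-ℓ) * (q - 1)`.

Powers of `q` are coprime to `q^j - 1` for `j > 0`. -/

open Module

/-! ### Alternating forms and their nonvanishing tuples -/

section AlternatingCounting

variable {F : Type*} [Field F] {V : Type*} [AddCommGroup V] [Module F V]

theorem AlternatingMap.linearIndependent_of_ne_zero {k : ℕ} (f : V [⋀^Fin k]→ₗ[F] F)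
    {v : Fin k → V} (hv : f v ≠ 0) : LinearIndependent F v := by
  by_contra h
  exact hv (f.map_linearDependent v h)

/-- A nonzero alternating `k`-form has, given a tuple `v` on which it does not vanish, every other
vector congruent modulo the span of `v` to one that annihilates all slots. -/
theorem AlternatingMap.exists_update_eq_zero {k : ℕ} (f : V [⋀^Fin k]→ₗ[F] F) {v : Fin k → V}
    (hv : f v ≠ 0) (x : V) :
    ∃ u, x - u ∈ Submodule.span F (Set.range v) ∧ ∀ i, f (Function.update v i u) = 0 := by
  -- Cramer's rule: in slot `i` only the term `j = i` survives, and it cancels `x`.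
  refine ⟨x - ∑ j, (f (Function.update v j x) / f v) • v j, ?_, fun i => ?_⟩
  · rw [sub_sub_cancel]
    exact Submodule.sum_mem _ fun j _ => Submodule.smul_mem _ _ (Submodule.subset_span ⟨j, rfl⟩)
  · rw [f.map_update_sub, f.map_update_sum, Finset.sum_eq_single i]
    · rw [f.map_update_smul, Function.update_eq_self, smul_eq_mul, div_mul_cancel₀ _ hv, sub_self]
    · intro j _ hj
      rw [f.map_update_smul, f.map_update_self v hj.symm, smul_zero]
    · simp

/-- It suffices to compare on distinct basis vectors. If `b 0` is absent, `p` fixes them all;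
otherwise both sides vanish. -/
theorem AlternatingMap.eq_compLinearMap_of_update_eq_zero {k : ℕ} (f : V [⋀^Fin k]→ₗ[F] F)
    (b : Basis (Fin (k + 1)) F V)
    (hb : ∀ i, f (Function.update (Fin.tail b) i (b 0)) = 0) (p : V →ₗ[F] V)
    (h0 : p (b 0) = 0) (hs : ∀ i : Fin k, p (b i.succ) = b i.succ) :
    f = f.compLinearMap p := by
  refine Basis.ext_alternating b fun t ht => ?_
  rw [AlternatingMap.compLinearMap_apply]
  by_cases h : ∃ j, t j = 0
  · obtain ⟨j, hj⟩ := h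
    rw [f.map_coord_zero (m := fun i => p (b (t i))) j (by rw [hj, h0])]
    obtain ⟨i, hi⟩ : ∃ i : Fin k, i.succ ∉ Set.range t := by
      by_contra! hcon
      have hsurj : Function.Surjective t := by
        intro a
        induction a using Fin.cases with
        | zero => exact ⟨j, hj⟩
        | succ i => exact hcon i
      have := Fintype.card_le_of_surjective t hsurj
      simp at this
    have hne : ∀ a, a ≠ j → t a ≠ 0 := fun a ha h => ha (ht (h.trans hj.symm))
    -- The index `0` is traded for the missing `i.succ`, which makes `t` a permutation of the slots.
    let w : Fin k → Fin k := fun a => if h : a = j then i else (t a).pred (hne a h)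
    have hwj : w j = i := by simp [w]
    have hw : ∀ a, a ≠ j → (w a).succ = t a := fun a ha => by simp [w, ha]
    have hwi : ∀ a, a ≠ j → w a ≠ i := fun a ha h => hi ⟨a, by rw [← hw a ha, h]⟩
    have hinj : Function.Injective w := by
      intro a a' h
      by_cases ha : a = j <;> by_cases ha' : a' = j
      · rw [ha, ha']
      · exact absurd (by rw [← h, ha, hwj]) (hwi a' ha')
      · exact absurd (by rw [h, ha', hwj]) (hwi a ha)
      · exact ht (by rw [← hw a ha, ← hw a' ha', h])
    have : (fun a => b (t a)) = Function.update (Fin.tail b) i (b 0) ∘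
        Equiv.ofBijective w hinj.bijective_of_finite := by
      funext a
      by_cases ha : a = j
      · subst ha
        simp [hwj, hj]
      · simp [Function.update_of_ne (hwi a ha), Fin.tail, hw a ha]
    rw [this, f.map_perm, hb, smul_zero]
  · push Not at h
    congr 1
    funext i
    obtain ⟨a, ha⟩ := Fin.exists_succ_eq.2 (h i)
    simp [← ha, hs]

variable [FiniteDimensional F V]

/-- Top forms are multiples of the determinant in any basis. -/
theorem AlternatingMap.apply_ne_zero_iff_linearIndependent {k : ℕ} (hk : finrank F V = k)
    {f : V [⋀^Fin k]→ₗ[F] F} (hf : f ≠ 0) (v : Fin k → V) :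
    f v ≠ 0 ↔ LinearIndependent F v := by
  refine ⟨f.linearIndependent_of_ne_zero, fun hv h0 => hf ?_⟩
  have := f.eq_smul_basis_det (basisOfLinearIndependentOfCardEqFinrank' v hv (by simp [hk]))
  simpa [h0] using this

theorem LinearIndependent.span_range_coe_eq {k : ℕ} {W : Submodule F V} (hW : finrank F W = k)
    {s : Fin k → W} (hs : LinearIndependent F s) :
    Submodule.span F (Set.range fun i => (s i : V)) = W := by
  have h1 : LinearIndependent F fun i => (s i : V) := hs.map' _ (Submodule.ker_subtype W)
  refine Submodule.eq_of_le_of_finrank_eq ?_ ?_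
  · rw [Submodule.span_le]
    rintro _ ⟨i, rfl⟩
    exact (s i).2
  · rw [finrank_span_eq_card h1, hW, Fintype.card_fin]

/-- Linearly independent tuples, grouped by the subspace they span. -/
noncomputable def sigmaLinearIndependentEquiv (k : ℕ) (Q : (Fin k → V) → Prop) :
    (Σ W : {W : Submodule F V // finrank F W = k},
        {s : Fin k → W.1 // LinearIndependent F s ∧ Q fun i => (s i : V)}) ≃
      {s : Fin k → V // LinearIndependent F s ∧ Q s} :=
  Equiv.ofBijective
    (fun p => ⟨fun i => p.2.1 i, p.2.2.1.map' _ (Submodule.ker_subtype _), p.2.2.2⟩) <| by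
    constructor
    · rintro ⟨⟨W, hW⟩, s, hs, hQ⟩ ⟨⟨W', hW'⟩, s', hs', hQ'⟩ h
      have h2 : (fun i => (s i : V)) = fun i => (s' i : V) := congrArg Subtype.val h
      have h3 : W = W' := by
        rw [← hs.span_range_coe_eq hW, ← hs'.span_range_coe_eq hW', h2]
      subst h3
      have h4 : s = s' := funext fun i => Subtype.ext (congrFun h2 i)
      subst h4
      rfl
    · rintro ⟨s, hs, hQ⟩
      refine ⟨⟨⟨Submodule.span F (Set.range s), ?_⟩,
        ⟨fun i => ⟨s i, Submodule.subset_span ⟨i, rfl⟩⟩, ?_, hQ⟩⟩, rfl⟩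
      · rw [finrank_span_eq_card hs, Fintype.card_fin]
      · exact LinearIndependent.of_comp (Submodule.subtype _) hs

/-! ### Counting over a finite field -/

variable [Fintype F]

/-- If the number of admissible bases of each `k`-dimensional subspace `W` is `C` or `0` according
to a predicate `P W`, the number of admissible independent tuples is `C` times the number of `W`
satisfying `P`. -/
theorem card_linearIndependent_and_eq_mul (k : ℕ) (Q : (Fin k → V) → Prop)
    (P : {W : Submodule F V // finrank F W = k} → Prop) (C : ℕ)
    (h1 : ∀ W, P W → Nat.card
      {s : Fin k → W.1 // LinearIndependent F s ∧ Q fun i => (s i : V)} = C)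
    (h0 : ∀ W, ¬ P W → Nat.card
      {s : Fin k → W.1 // LinearIndependent F s ∧ Q fun i => (s i : V)} = 0) :
    Nat.card {s : Fin k → V // LinearIndependent F s ∧ Q s} = Nat.card {W // P W} * C := by
  classical
  have : Finite V := Module.finite_of_finite F
  have := Fintype.ofFinite {W : Submodule F V // finrank F W = k}
  rw [← Nat.card_congr (sigmaLinearIndependentEquiv k Q), Nat.card_sigma, Nat.card_eq_fintype_card,
    Fintype.card_subtype, ← smul_eq_mul, ← Finset.sum_const, Finset.sum_filter]
  refine Finset.sum_congr rfl fun W _ => ?_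
  split_ifs with h
  · exact h1 W h
  · exact h0 W h

/-- The number of `k`-dimensional subspaces on which an alternating form does not vanish. -/
noncomputable def AlternatingMap.weight {k : ℕ} (f : V [⋀^Fin k]→ₗ[F] F) : ℕ :=
  Nat.card {W : {W : Submodule F V // finrank F W = k} // f.compLinearMap W.1.subtype ≠ 0}

theorem AlternatingMap.card_apply_ne_zero {k : ℕ} (f : V [⋀^Fin k]→ₗ[F] F) :
    Nat.card {v // f v ≠ 0} =
      f.weight * ∏ i : Fin k, (Fintype.card F ^ k - Fintype.card F ^ (i : ℕ)) := by
  have : Finite V := Module.finite_of_finite F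
  rw [AlternatingMap.weight, ← card_linearIndependent_and_eq_mul k (fun v => f v ≠ 0)]
  · exact Nat.card_congr (Equiv.subtypeEquivRight fun v =>
      ⟨fun h => ⟨f.linearIndependent_of_ne_zero h, h⟩, And.right⟩)
  · intro W hW
    have := card_linearIndependent (K := F) (V := W.1) W.2.ge
    rw [W.2] at this
    rw [← this]
    exact Nat.card_congr (Equiv.subtypeEquivRight fun s =>
      ⟨And.left, fun h => ⟨h, (apply_ne_zero_iff_linearIndependent W.2 hW s).2 h⟩⟩)
  · intro W hW
    rw [not_not] at hW
    have : IsEmpty {s : Fin k → W.1 // LinearIndependent F s ∧ f (fun i => (s i : V)) ≠ 0} :=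
      ⟨fun s => s.2.2 (DFunLike.congr_fun hW s.1)⟩
    exact Nat.card_of_isEmpty

theorem LinearMap.card_apply_ne_zero {φ : V →ₗ[F] F} (hφ : φ ≠ 0) :
    Nat.card {x // φ x ≠ 0} =
      Fintype.card F ^ (finrank F V - 1) * (Fintype.card F - 1) := by
  classical
  have : Finite V := Module.finite_of_finite F
  have := Fintype.ofFinite V
  have hr : finrank F (LinearMap.ker φ) = finrank F V - 1 := by
    have h1 := φ.finrank_range_add_finrank_ker
    rw [LinearMap.range_eq_top.2 (LinearMap.surjective hφ), finrank_top, finrank_self] at h1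
    omega
  have hpos : 1 ≤ finrank F V := by
    have h1 := φ.finrank_range_add_finrank_ker
    rw [LinearMap.range_eq_top.2 (LinearMap.surjective hφ), finrank_top, finrank_self] at h1
    omega
  have hk : Fintype.card {x // φ x = 0} = Fintype.card F ^ (finrank F V - 1) := by
    rw [← hr, ← Module.card_eq_pow_finrank (K := F) (V := LinearMap.ker φ)]
    exact Fintype.card_congr (Equiv.refl _)
  rw [Nat.card_eq_fintype_card, Fintype.card_subtype_compl, hk,
    Module.card_eq_pow_finrank (K := F) (V := V), Nat.mul_sub, mul_one, ← pow_succ,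
    Nat.sub_add_cancel hpos]

theorem LinearIndependent.card_notMem_span {k : ℕ} {v : Fin k → V} (hv : LinearIndependent F v) :
    Nat.card {x // x ∉ Submodule.span F (Set.range v)} =
      Fintype.card F ^ finrank F V - Fintype.card F ^ k := by
  classical
  have : Finite V := Module.finite_of_finite F
  have := Fintype.ofFinite V
  rw [Nat.card_eq_fintype_card, Fintype.card_subtype_compl,
    Module.card_eq_pow_finrank (K := F) (V := V),
    Module.card_eq_pow_finrank (K := F) (V := Submodule.span F (Set.range v)),
    finrank_span_eq_card hv, Fintype.card_fin]

/-- Extending the tuples on which a form does not vanish by one independent vector. -/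
theorem AlternatingMap.card_linearIndependent_tail_ne_zero {k : ℕ} (f : V [⋀^Fin k]→ₗ[F] F) :
    Nat.card {s : Fin (k + 1) → V // LinearIndependent F s ∧ f (Fin.tail s) ≠ 0} =
      Nat.card {v // f v ≠ 0} * (Fintype.card F ^ finrank F V - Fintype.card F ^ k) := by
  classical
  have : Finite V := Module.finite_of_finite F
  have := Fintype.ofFinite {v // f v ≠ 0}
  let e : {s : Fin (k + 1) → V // LinearIndependent F s ∧ f (Fin.tail s) ≠ 0} ≃
      Σ v : {v // f v ≠ 0}, {x // x ∉ Submodule.span F (Set.range v.1)} :=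
    { toFun := fun s => ⟨⟨Fin.tail s.1, s.2.2⟩, ⟨s.1 0, (linearIndependent_finSucc.1 s.2.1).2⟩⟩
      invFun := fun p => ⟨Fin.cons p.2.1 p.1.1, linearIndependent_finCons.2
        ⟨f.linearIndependent_of_ne_zero p.1.2, p.2.2⟩, by simpa using p.1.2⟩
      left_inv := fun s => Subtype.ext (Fin.cons_self_tail s.1)
      right_inv := fun p => rfl }
  rw [Nat.card_congr e, Nat.card_sigma, Nat.card_eq_fintype_card (α := {v // f v ≠ 0}),
    ← smul_eq_mul, ← Finset.card_univ, ← Finset.sum_const]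
  exact Finset.sum_congr rfl fun v _ => (f.linearIndependent_of_ne_zero v.2).card_notMem_span

/-- In a basis `u, v` with `u` in the kernel of `f`, the `u`-coordinates of the `k` arguments are
free (`q^k` choices) and the others form an invertible `k × k` matrix. -/
theorem AlternatingMap.card_apply_ne_zero_of_finrank_eq_succ {k : ℕ} (hk : finrank F V = k + 1)
    {f : V [⋀^Fin k]→ₗ[F] F} (hf : f ≠ 0) :
    Nat.card {v // f v ≠ 0} = Fintype.card F ^ k *
      ∏ i : Fin k, (Fintype.card F ^ k - Fintype.card F ^ (i : ℕ)) := by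
  obtain ⟨v, hv⟩ : ∃ v, f v ≠ 0 := by
    by_contra! h
    exact hf (AlternatingMap.ext h)
  have hli := f.linearIndependent_of_ne_zero hv
  obtain ⟨x, hx⟩ : ∃ x, x ∉ Submodule.span F (Set.range v) := by
    by_contra! h
    have h1 := finrank_span_eq_card hli
    rw [Submodule.eq_top_iff'.2 h, finrank_top, hk, Fintype.card_fin] at h1
    omega
  obtain ⟨u, hxu, hu⟩ := f.exists_update_eq_zero hv x
  have hus : u ∉ Submodule.span F (Set.range v) := fun h => hx (by
    simpa using Submodule.add_mem _ hxu h)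
  let b : Basis (Fin (k + 1)) F V := basisOfLinearIndependentOfCardEqFinrank'
    (Fin.cons u v : Fin (k + 1) → V) (linearIndependent_finCons.2 ⟨hli, hus⟩) (by simp [hk])
  have hb : ⇑b = (Fin.cons u v : Fin (k + 1) → V) :=
    coe_basisOfLinearIndependentOfCardEqFinrank' ..
  let r : V →ₗ[F] (Fin k → F) := LinearMap.funLeft F F Fin.succ ∘ₗ b.equivFun.toLinearMap
  let g := f.compLinearMap (Fintype.linearCombination F v)
  have hg : g ≠ 0 := fun h => hv (by
    have h1 : g (fun i => Pi.single i 1) = 0 := by rw [h]; rfl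
    simpa [g] using h1)
  have hfg : ∀ y, f y = g fun i => r (y i) := fun y => by
    have := f.eq_compLinearMap_of_update_eq_zero b (by simpa [hb] using hu)
      (Fintype.linearCombination F v ∘ₗ r)
      (by
        have : r (b 0) = 0 := by
          ext i
          simp [r, LinearMap.funLeft_apply]
        simp [this])
      (fun i => by
        have : r (b i.succ) = Pi.single i 1 := by
          ext j
          simp [r, LinearMap.funLeft_apply, Finsupp.single_apply, Pi.single_apply, eq_comm]
        rw [LinearMap.comp_apply, this]
        simp [hb])
    rw [DFunLike.congr_fun this y]
    rfl
  let e : (Fin k → V) ≃ (Fin k → F) × (Fin k → Fin k → F) :=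
    (Equiv.piCongrRight fun _ => b.equivFun.toEquiv.trans (Fin.consEquiv fun _ => F).symm).trans
      (Equiv.arrowProdEquivProdArrow _ _ _)
  let e₁ : {y // f y ≠ 0} ≃ {p : (Fin k → F) × (Fin k → Fin k → F) // g p.2 ≠ 0} :=
    e.subtypeEquiv fun y => by rw [hfg y]; rfl
  let e₂ : {p : (Fin k → F) × (Fin k → Fin k → F) // g p.2 ≠ 0} ≃
      (Fin k → F) × {a : Fin k → Fin k → F // LinearIndependent F a} :=
    { toFun := fun p => ⟨p.1.1, p.1.2, g.linearIndependent_of_ne_zero p.2⟩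
      invFun := fun p => ⟨⟨p.1, p.2.1⟩,
        (apply_ne_zero_iff_linearIndependent (by simp) hg _).2 p.2.2⟩
      left_inv := fun _ => rfl
      right_inv := fun _ => rfl }
  rw [Nat.card_congr (e₁.trans e₂), Nat.card_prod, card_linearIndependent (by simp)]
  simp

theorem Fintype.prod_pow_sub_pow_pos (F : Type*) [Field F] [Fintype F] (k : ℕ) :
    0 < ∏ i : Fin k, (Fintype.card F ^ k - Fintype.card F ^ (i : ℕ)) :=
  Finset.prod_pos fun i _ => Nat.sub_pos_of_lt
    (Nat.pow_lt_pow_right Fintype.one_lt_card i.2)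

theorem Nat.pow_dvd_of_dvd_mul_pow_sub_one {q a n j : ℕ} (hq : 0 < q) (hj : 0 < j)
    (h : q ^ a ∣ n * (q ^ j - 1)) : q ^ a ∣ n := by
  refine Nat.Coprime.dvd_of_dvd_mul_right (Nat.Coprime.pow_left _ ?_) h
  obtain ⟨i, rfl⟩ := Nat.exists_eq_succ_of_ne_zero hj.ne'
  rw [Nat.coprime_iff_isRelPrime]
  intro d hd hd'
  rw [Nat.isUnit_iff, ← Nat.dvd_one]
  have h1 : d ∣ q ^ (i + 1) := hd.trans (dvd_pow_self q (by omega))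
  have := (Nat.dvd_sub h1 hd')
  rwa [Nat.sub_sub_self (Nat.one_le_pow _ _ hq)] at this

theorem AlternatingMap.pow_dvd_weight {k : ℕ} (f : V [⋀^Fin k]→ₗ[F] F) (hk : k < finrank F V) :
    Fintype.card F ^ k ∣ f.weight := by
  have : Finite V := Module.finite_of_finite F
  have hG := Fintype.prod_pow_sub_pow_pos F k
  have hq : 0 < Fintype.card F := Fintype.card_pos
  have h1 := f.card_linearIndependent_tail_ne_zero
  rw [f.card_apply_ne_zero] at h1
  have h2 := card_linearIndependent_and_eq_mul (F := F) (k + 1) (fun s => f (Fin.tail s) ≠ 0)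
    (fun X => f.compLinearMap X.1.subtype ≠ 0)
    (Fintype.card F ^ k * (∏ i : Fin k, (Fintype.card F ^ k - Fintype.card F ^ (i : ℕ))) *
      (Fintype.card F ^ (k + 1) - Fintype.card F ^ k))
    (fun X hX => by
      rw [← AlternatingMap.card_apply_ne_zero_of_finrank_eq_succ X.2 hX]
      have := (f.compLinearMap X.1.subtype).card_linearIndependent_tail_ne_zero
      rw [X.2] at this
      exact this)
    (fun X hX => by
      rw [not_not] at hX
      have : IsEmpty {s : Fin (k + 1) → X.1 //
          LinearIndependent F s ∧ f (Fin.tail fun i => (s i : V)) ≠ 0} :=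
        ⟨fun s => s.2.2 (DFunLike.congr_fun hX (Fin.tail s.1))⟩
      exact Nat.card_of_isEmpty)
  rw [h1] at h2
  generalize ∏ i : Fin k, (Fintype.card F ^ k - Fintype.card F ^ (i : ℕ)) = G at *
  generalize Nat.card {X : {X : Submodule F V // finrank F X = k + 1} //
    f.compLinearMap X.1.subtype ≠ 0} = N at *
  generalize Fintype.card F = q at *
  obtain ⟨j, hj⟩ := Nat.exists_eq_add_of_lt hk
  have e1 : q ^ finrank F V - q ^ k = q ^ k * (q ^ (j + 1) - 1) := by
    rw [hj, Nat.mul_sub, mul_one, ← pow_add, add_assoc]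
  have e2 : q ^ (k + 1) - q ^ k = q ^ k * (q - 1) := by
    rw [Nat.mul_sub, mul_one, ← pow_succ]
  rw [e1, e2] at h2
  -- Here `j + 1 = finrank F V - k`, positive by `hk`; the common factor `G * q ^ k` cancels.
  refine Nat.pow_dvd_of_dvd_mul_pow_sub_one hq j.succ_pos ⟨N * (q - 1), ?_⟩
  refine Nat.eq_of_mul_eq_mul_left (Nat.mul_pos hG (pow_pos hq k)) ?_
  linear_combination h2

theorem AlternatingMap.pow_sub_dvd_weight {k : ℕ} (f : V [⋀^Fin (k + 1)]→ₗ[F] F)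
    (hk : k + 1 ≤ finrank F V) :
    Fintype.card F ^ (finrank F V - (k + 1)) ∣ f.weight := by
  classical
  have : Finite V := Module.finite_of_finite F
  have hG := Fintype.prod_pow_sub_pow_pos F k
  have hq : 0 < Fintype.card F := Fintype.card_pos
  let φ (u : Fin k → V) : V →ₗ[F] F :=
    { toFun := fun x => f.curryLeft x u
      map_add' := fun x y => by rw [map_add]; rfl
      map_smul' := fun a x => by rw [map_smul]; rfl }
  have hφ : ∀ u, φ u ≠ 0 → LinearIndependent F u := fun u h => by
    obtain ⟨x, hx⟩ : ∃ x, φ u x ≠ 0 := by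
      by_contra! h'
      exact h (LinearMap.ext h')
    exact (f.curryLeft x).linearIndependent_of_ne_zero hx
  have := Fintype.ofFinite {u // LinearIndependent F u ∧ φ u ≠ 0}
  let e : {v // f v ≠ 0} ≃ Σ u : {u // LinearIndependent F u ∧ φ u ≠ 0}, {x // φ u.1 x ≠ 0} :=
    { toFun := fun v =>
        have h : φ (Fin.tail v.1) (v.1 0) ≠ 0 := by
          have : (Matrix.vecCons (v.1 0) (Fin.tail v.1)) = v.1 := Fin.cons_self_tail v.1
          change f (Matrix.vecCons _ _) ≠ 0
          rw [this]
          exact v.2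
        have h' : φ (Fin.tail v.1) ≠ 0 := fun h0 => h (by rw [h0]; rfl)
        ⟨⟨Fin.tail v.1, hφ _ h', h'⟩, v.1 0, h⟩
      invFun := fun p => ⟨Fin.cons p.2.1 p.1.1, p.2.2⟩
      left_inv := fun v => Subtype.ext (Fin.cons_self_tail v.1)
      right_inv := fun p => rfl }
  have h1 : Nat.card {v // f v ≠ 0} = Nat.card {u // LinearIndependent F u ∧ φ u ≠ 0} *
      (Fintype.card F ^ (finrank F V - 1) * (Fintype.card F - 1)) := by
    rw [Nat.card_congr e, Nat.card_sigma,
      Nat.card_eq_fintype_card (α := {u // LinearIndependent F u ∧ φ u ≠ 0}),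
      ← smul_eq_mul, ← Finset.card_univ, ← Finset.sum_const]
    exact Finset.sum_congr rfl fun u _ => LinearMap.card_apply_ne_zero u.2.2
  rw [f.card_apply_ne_zero, card_linearIndependent_and_eq_mul (F := F) k (fun u => φ u ≠ 0)
    (fun W => ∃ x, (f.curryLeft x).compLinearMap W.1.subtype ≠ 0)
    (∏ i : Fin k, (Fintype.card F ^ k - Fintype.card F ^ (i : ℕ)))
    -- One `x` for which the form is nonzero on `W` makes `φ s ≠ 0` for every basis `s` of `W`.
    (fun W ⟨x, hx⟩ => by
      have := card_linearIndependent (K := F) (V := W.1) W.2.ge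
      rw [W.2] at this
      rw [← this]
      exact Nat.card_congr (Equiv.subtypeEquivRight fun s => ⟨And.left, fun h => ⟨h, fun h0 =>
        (apply_ne_zero_iff_linearIndependent W.2 hx s).2 h (LinearMap.congr_fun h0 x)⟩⟩))
    (fun W hW => by
      push Not at hW
      have : IsEmpty {s : Fin k → W.1 // LinearIndependent F s ∧ φ (fun i => (s i : V)) ≠ 0} :=
        ⟨fun s => s.2.2 (LinearMap.ext fun x => DFunLike.congr_fun (hW x) s.1)⟩
      exact Nat.card_of_isEmpty)] at h1
  -- Relates `|GL_(k+1)|` to `|GL_k|`: each factor after the first yields one `q`.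
  have hP : ∏ i : Fin (k + 1), (Fintype.card F ^ (k + 1) - Fintype.card F ^ (i : ℕ)) =
      (Fintype.card F ^ (k + 1) - 1) * (Fintype.card F ^ k *
        ∏ i : Fin k, (Fintype.card F ^ k - Fintype.card F ^ (i : ℕ))) := by
    rw [Fin.prod_univ_succ]
    congr 1
    have hc : Fintype.card F ^ k = ∏ _i : Fin k, Fintype.card F := by simp
    conv_rhs => enter [1]; rw [hc]
    rw [← Finset.prod_mul_distrib]
    refine Finset.prod_congr rfl fun i _ => ?_
    rw [Nat.mul_sub, Fin.val_succ, pow_succ', pow_succ']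
  rw [hP] at h1
  generalize ∏ i : Fin k, (Fintype.card F ^ k - Fintype.card F ^ (i : ℕ)) = G at *
  generalize Nat.card {W : {W : Submodule F V // finrank F W = k} //
    ∃ x, (f.curryLeft x).compLinearMap W.1.subtype ≠ 0} = N at *
  generalize Fintype.card F = q at *
  obtain ⟨j, hj⟩ := Nat.exists_eq_add_of_le hk
  have e1 : q ^ (finrank F V - 1) = q ^ k * q ^ j := by
    rw [← pow_add]
    congr 1
    omega
  have e2 : finrank F V - (k + 1) = j := by omega
  rw [e1] at h1
  rw [e2]
  refine Nat.pow_dvd_of_dvd_mul_pow_sub_one hq k.succ_pos ⟨N * (q - 1), ?_⟩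
  refine Nat.eq_of_mul_eq_mul_left (Nat.mul_pos hG (pow_pos hq k)) ?_
  linear_combination h1

end AlternatingCounting

/-! ### From codewords to alternating forms -/

section GrassmannCode

variable {F : Type*} [Field F] {ℓ m : ℕ} {M : GrassmannSet F ℓ m → Matrix (Fin ℓ) (Fin m) F}

/-- Every codeword of the Grassmann code is the evaluation of an alternating form at the rows of
the chosen matrices. -/
theorem exists_alternatingMap_of_mem_grassmannCode {c : GrassmannSet F ℓ m → F}
    (hc : c ∈ grassmannCode M) :
    ∃ f : (Fin m → F) [⋀^Fin ℓ]→ₗ[F] F, ∀ W, c W = f (M W).row := by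
  induction hc using Submodule.span_induction with
  | mem x hx =>
    obtain ⟨I, rfl⟩ := hx
    exact ⟨Matrix.detRowAlternating.compLinearMap (LinearMap.funLeft F F I), fun W => rfl⟩
  | zero => exact ⟨0, fun W => rfl⟩
  | add x y _ _ hx hy =>
    obtain ⟨f, hf⟩ := hx
    obtain ⟨g, hg⟩ := hy
    exact ⟨f + g, fun W => by simp [hf, hg]⟩
  | smul a x _ hx =>
    obtain ⟨f, hf⟩ := hx
    exact ⟨a • f, fun W => by simp [hf]⟩

theorem IsRowSpaceChoice.apply_row_ne_zero_iff (hM : IsRowSpaceChoice M)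
    (f : (Fin m → F) [⋀^Fin ℓ]→ₗ[F] F) (W : GrassmannSet F ℓ m) :
    f (M W).row ≠ 0 ↔ f.compLinearMap W.1.subtype ≠ 0 := by
  have hmem : ∀ i, (M W).row i ∈ W.1 := fun i => hM W ▸ Submodule.subset_span ⟨i, rfl⟩
  have hli : LinearIndependent F (M W).row := by
    rw [linearIndependent_iff_card_eq_finrank_span, Fintype.card_fin, Set.finrank, hM W, W.2]
  have hli' : LinearIndependent F fun i => (⟨(M W).row i, hmem i⟩ : W.1) :=
    LinearIndependent.of_comp W.1.subtype hli
  refine ⟨fun h h0 => h ?_, fun h => ?_⟩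
  · exact DFunLike.congr_fun h0 fun i => (⟨(M W).row i, hmem i⟩ : W.1)
  · exact (AlternatingMap.apply_ne_zero_iff_linearIndependent W.2 h _).2 hli'

end GrassmannCode

theorem mainTheorem6 {F : Type*} [Field F] [Fintype F] (ℓ m : ℕ) (hℓ : 1 ≤ ℓ) (hℓm : ℓ ≤ m)
    (M : GrassmannSet F ℓ m → Matrix (Fin ℓ) (Fin m) F) (hM : IsRowSpaceChoice M)
    (c : GrassmannSet F ℓ m → F) (hc : c ∈ grassmannCode M) :
    (ℓ < m → Fintype.card F ^ ℓ ∣ (Function.support c).ncard) ∧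
      Fintype.card F ^ (m - ℓ) ∣ (Function.support c).ncard := by
  obtain ⟨f, hf⟩ := exists_alternatingMap_of_mem_grassmannCode hc
  have hw : (Function.support c).ncard = f.weight := by
    rw [← Nat.card_coe_set_eq, AlternatingMap.weight]
    exact Nat.card_congr (Equiv.subtypeEquivRight fun W => by
      rw [Function.mem_support, hf W, hM.apply_row_ne_zero_iff f W])
  rw [hw]
  refine ⟨fun h => f.pow_dvd_weight (by simpa using h), ?_⟩
  -- Since `ℓ ≥ 1`, there is a first slot to split off.
  obtain ⟨k, rfl⟩ := Nat.exists_eq_add_of_le' hℓ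
  simpa using f.pow_sub_dvd_weight (by simpa using hℓm)
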